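/- Let $T>0$, $x_0\in\mathbb{R}$, and let $q,c:\mathbb{R}\to\mathbb{R}$ be (globally) Lipschitz functions such that $$q(x)\,\bigl(q(x)-c(x)\bigr)>0\qquad\text{for every }x\in\mathbb{R}.$$ Consider the optimal control problem $$\text{Minimize in }u:\quad \int_0^T\bigl[c(x(t))\,u(t)+u(t)^2\bigr]\,dt$$ over all measurable controls $u:(0,T)\to\mathbb{R}$ with $|u(t)|\le 1$ for almost every $t\in(0,T)$, where the state $x:[0,T]\to\mathbb{R}$ is absolutely continuous and satisfies $$x'(t)=q(x(t))\,u(t)+u(t)^2\quad\text{for a.e. }t\in(0,T),\qquad x(0)=x_0.$$ Then this problem admits a solution: there are an admissible control $u$ and a corresponding state $x$ whose cost is finite and is less than or equal to the cost of every admissible control $v$ with corresponding state $y$ (all these costs being finite). -/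

import Mathlib

open MeasureTheory Set

/-- Admissible controls: essentially bounded measurable functions `u` on `(0, T)` with
`|u(t)| ≤ 1` for almost every `t`. -/
def IsAdmissibleControl (T : ℝ) (u : ℝ → ℝ) : Prop :=
  AEMeasurable u (volume.restrict (Ioo 0 T)) ∧
    ∀ᵐ t ∂(volume.restrict (Ioo 0 T)), |u t| ≤ 1

/-- `x` is a state driven by the control `u` from `x₀`: an absolutely continuous function on
`[0, T]` with `x(0) = x₀` and `x'(t) = q(x(t)) u(t) + u(t)²` for almost every `t ∈ (0, T)`. -/
def IsStateOf (T x₀ : ℝ) (q u x : ℝ → ℝ) : Prop :=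
  AbsolutelyContinuousOnInterval x 0 T ∧ x 0 = x₀ ∧
    ∀ᵐ t ∂(volume.restrict (Ioo 0 T)), HasDerivAt x (q (x t) * u t + u t ^ 2) t

/-- The running cost `c(x(t)) u(t) + u(t)²`. -/
def runningCost (c u x : ℝ → ℝ) (t : ℝ) : ℝ :=
  c (x t) * u t + u t ^ 2

/-- The cost functional `∫₀ᵀ (c(x(t)) u(t) + u(t)²) dt`. -/
noncomputable def totalCost (T : ℝ) (c u x : ℝ → ℝ) : ℝ :=
  ∫ t in (0 : ℝ)..T, runningCost c u x t

/-- `u` is an optimal control: it is admissible and has a state `x`, and every admissible control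
`v` with a state `y` has a finite (integrable) cost that is at least the cost of `u`.
The case `v = u` gives the integrability of the cost of `u` itself. -/
def IsOptimalControl (T x₀ : ℝ) (q c u : ℝ → ℝ) : Prop :=
  IsAdmissibleControl T u ∧ ∃ x : ℝ → ℝ, IsStateOf T x₀ q u x ∧
    ∀ v y : ℝ → ℝ, IsAdmissibleControl T v → IsStateOf T x₀ q v y →
      IntervalIntegrable (runningCost c v y) volume 0 T ∧
        totalCost T c u x ≤ totalCost T c v y

/-! The set of pairs (velocity, running cost) need not be convex, so limits of a minimizing sequence
are taken in relaxed form. The controls, their squares, the states and the accumulated costs have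
equi-Lipschitz primitives or paths. Their limits satisfy `X' = q(X) v + m` and `C' = c(X) v + m`
with `v² ≤ m ≤ 1`, where `v = U'` and `m = M'` (`exists_relaxed_minimizer`).

The relaxation is then removed without moving `X`. For `q > 0`, the larger root `w` of `w² + q w = q
v + m` satisfies `v ≤ w` and `|w| ≤ 1` (`larger_root_spec`). As `c < q`, `c w + w² = q v + m - (q -
c) w ≤ c v + m`, so `w` costs at most the infimum. The case `q < 0` follows by changing the signs of
`u`, `q` and `c`. -/

open Filter Topology

/-! ### Integral estimates for admissible controls -/

namespace IsAdmissibleControl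

variable {T : ℝ} {u : ℝ → ℝ}

lemma ae_mem_uIoc (hu : IsAdmissibleControl T u) {a b : ℝ} (ha : a ∈ Icc 0 T) (hb : b ∈ Icc 0 T) :
    ∀ᵐ t, t ∈ uIoc a b → |u t| ≤ 1 ∧ t ∈ Icc 0 T ∧ t ∈ uIcc a b := by
  have h := (ae_restrict_iff' measurableSet_Ioo).1 hu.2
  filter_upwards [h, Measure.ae_ne volume T] with t ht htT hmem
  have h1 : t ∈ uIcc a b := uIoc_subset_uIcc hmem
  have h2 : t ∈ Icc 0 T := uIcc_subset_Icc ha hb h1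
  have h3 : 0 < t := lt_of_le_of_lt (le_min ha.1 hb.1) hmem.1
  exact ⟨ht ⟨h3, lt_of_le_of_ne h2.2 htT⟩, h2, h1⟩

lemma intervalIntegrable_mul_add_sq (hu : IsAdmissibleControl T u) {g : ℝ → ℝ}
    (hg : ContinuousOn g (Icc 0 T)) (m : ℝ) {a b : ℝ} (ha : a ∈ Icc 0 T) (hb : b ∈ Icc 0 T) :
    IntervalIntegrable (fun t => g t * u t + m * u t ^ 2) volume a b := by
  have hT : 0 ≤ T := ha.1.trans ha.2
  have hu' : IntegrableOn u (Ioo 0 T) volume :=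
    Integrable.of_bound hu.1.aestronglyMeasurable 1 hu.2
  have hu2 : IntegrableOn (fun t => u t ^ 2) (Ioo 0 T) volume := by
    refine Integrable.of_bound (hu.1.pow_const 2).aestronglyMeasurable 1 ?_
    filter_upwards [hu.2] with t ht
    simpa using (sq_le_one_iff_abs_le_one _).2 ht
  have hui : IntervalIntegrable u volume a b := by
    refine IntervalIntegrable.mono_set (a := 0) (b := T) ?_ ?_
    · rwa [intervalIntegrable_iff_integrableOn_Ioo_of_le hT]
    · rw [uIcc_of_le hT]; exact uIcc_subset_Icc ha hb
  have hu2i : IntervalIntegrable (fun t => u t ^ 2) volume a b := by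
    refine IntervalIntegrable.mono_set (a := 0) (b := T) ?_ ?_
    · rwa [intervalIntegrable_iff_integrableOn_Ioo_of_le hT]
    · rw [uIcc_of_le hT]; exact uIcc_subset_Icc ha hb
  exact (hui.continuousOn_mul (hg.mono (uIcc_subset_Icc ha hb))).add (hu2i.const_mul m)

lemma intervalIntegrable (hu : IsAdmissibleControl T u) {a b : ℝ} (ha : a ∈ Icc 0 T)
    (hb : b ∈ Icc 0 T) : IntervalIntegrable u volume a b := by
  simpa using hu.intervalIntegrable_mul_add_sq (continuousOn_const (c := (1 : ℝ))) 0 ha hb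

lemma intervalIntegrable_sq (hu : IsAdmissibleControl T u) {a b : ℝ} (ha : a ∈ Icc 0 T)
    (hb : b ∈ Icc 0 T) : IntervalIntegrable (fun t => u t ^ 2) volume a b := by
  simpa using hu.intervalIntegrable_mul_add_sq (continuousOn_const (c := (0 : ℝ))) 1 ha hb

lemma intervalIntegrable_runningCost (hu : IsAdmissibleControl T u) {f x : ℝ → ℝ}
    (hf : Continuous f) (hx : ContinuousOn x (Icc 0 T)) {a b : ℝ} (ha : a ∈ Icc 0 T)
    (hb : b ∈ Icc 0 T) : IntervalIntegrable (runningCost f u x) volume a b := by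
  have h := hu.intervalIntegrable_mul_add_sq (hf.comp_continuousOn hx) 1 ha hb
  simp only [one_mul] at h
  exact h

lemma abs_integral_runningCost_le (hu : IsAdmissibleControl T u) {f x : ℝ → ℝ} {B : ℝ}
    (hB : ∀ t ∈ Icc 0 T, |f (x t)| ≤ B) {a b : ℝ} (ha : a ∈ Icc 0 T) (hb : b ∈ Icc 0 T) :
    |∫ t in a..b, runningCost f u x t| ≤ (B + 1) * |b - a| := by
  refine intervalIntegral.norm_integral_le_of_norm_le_const_ae (f := runningCost f u x) ?_
  filter_upwards [hu.ae_mem_uIoc ha hb] with t ht hmem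
  obtain ⟨h1, h2, -⟩ := ht hmem
  have h3 : |f (x t) * u t| ≤ B := by
    rw [abs_mul]
    nlinarith [hB t h2, abs_nonneg (f (x t)), abs_nonneg (u t)]
  have h4 : |u t ^ 2| ≤ 1 := by
    rw [abs_of_nonneg (sq_nonneg _)]; exact (sq_le_one_iff_abs_le_one _).2 h1
  exact (abs_add_le _ _).trans (add_le_add h3 h4)

/-- The integral of `f(x) u + u²` is, up to a quadratic error, affine in the integrals of `u`
and `u²`. -/
lemma abs_integral_runningCost_sub_le (hu : IsAdmissibleControl T u) {f x : ℝ → ℝ} {L : NNReal}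
    (hf : LipschitzWith L f) (hx : ContinuousOn x (Icc 0 T)) {K : ℝ}
    (hK : ∀ s ∈ Icc 0 T, ∀ t ∈ Icc 0 T, |x s - x t| ≤ K * |s - t|)
    (hK0 : 0 ≤ K) {a b : ℝ} (ha : a ∈ Icc 0 T) (hb : b ∈ Icc 0 T) :
    |(∫ t in a..b, runningCost f u x t) - f (x a) * (∫ t in a..b, u t) - ∫ t in a..b, u t ^ 2|
      ≤ L * K * |b - a| ^ 2 := by
  have hui := hu.intervalIntegrable ha hb
  have hu2 := hu.intervalIntegrable_sq ha hb
  have hc := hu.intervalIntegrable_runningCost hf.continuous hx ha hb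
  rw [← intervalIntegral.integral_const_mul, ← intervalIntegral.integral_sub hc (hui.const_mul _),
    ← intervalIntegral.integral_sub (hc.sub (hui.const_mul _)) hu2]
  have : L * K * |b - a| ^ 2 = (L * (K * |b - a|)) * |b - a| := by ring
  rw [this]
  refine intervalIntegral.norm_integral_le_of_norm_le_const_ae
    (f := fun t => runningCost f u x t - f (x a) * u t - u t ^ 2) ?_
  filter_upwards [hu.ae_mem_uIoc ha hb] with t ht hmem
  obtain ⟨h1, h2, h3⟩ := ht hmem
  have h4 : runningCost f u x t - f (x a) * u t - u t ^ 2 = (f (x t) - f (x a)) * u t := by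
    simp only [runningCost]; ring
  rw [h4, norm_mul, Real.norm_eq_abs, Real.norm_eq_abs]
  have h5 : |f (x t) - f (x a)| ≤ L * |x t - x a| := by
    simpa [Real.dist_eq] using hf.dist_le_mul (x t) (x a)
  have h6 : |t - a| ≤ |b - a| := abs_sub_left_of_mem_uIcc h3
  have h7 : |x t - x a| ≤ K * |b - a| := (hK t h2 a ha).trans (by gcongr)
  calc |f (x t) - f (x a)| * |u t| ≤ (L * |x t - x a|) * 1 := by gcongr
    _ ≤ L * (K * |b - a|) := by rw [mul_one]; gcongr

lemma neg (hu : IsAdmissibleControl T u) : IsAdmissibleControl T (fun t => -u t) :=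
  ⟨hu.1.neg, by simpa using hu.2⟩

end IsAdmissibleControl

/-! ### Integral form and a priori bounds for states -/

namespace IsStateOf

variable {T x₀ : ℝ} {q u x : ℝ → ℝ}

lemma continuousOn (hx : IsStateOf T x₀ q u x) (hT : 0 ≤ T) : ContinuousOn x (Icc 0 T) := by
  simpa [uIcc_of_le hT] using hx.1.continuousOn

lemma sub_eq_integral (hx : IsStateOf T x₀ q u x) {a b : ℝ}
    (ha : a ∈ Icc 0 T) (hb : b ∈ Icc 0 T) :
    x b - x a = ∫ t in a..b, runningCost q u x t := by
  have hT : 0 ≤ T := ha.1.trans ha.2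
  have hsub : uIcc a b ⊆ uIcc 0 T := by rw [uIcc_of_le hT]; exact uIcc_subset_Icc ha hb
  rw [← (hx.1.mono hsub).integral_deriv_eq_sub]
  refine intervalIntegral.integral_congr_ae ?_
  have h := (ae_restrict_iff' measurableSet_Ioo).1 hx.2.2
  filter_upwards [h, Measure.ae_ne volume T] with t ht htT hmem
  have h2 : t ∈ Icc 0 T := uIcc_subset_Icc ha hb (uIoc_subset_uIcc hmem)
  exact (ht ⟨lt_of_le_of_lt (le_min ha.1 hb.1) hmem.1, lt_of_le_of_ne h2.2 htT⟩).deriv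

lemma neg (hx : IsStateOf T x₀ q u x) : IsStateOf T x₀ (fun z => -q z) (fun t => -u t) x :=
  ⟨hx.1, hx.2.1, by simpa using hx.2.2⟩

/-- Almost everywhere `|x'| ≤ L |x - x₀| + |q x₀| + 1`, so the bound does not depend on the control.
-/
lemma abs_sub_le_gronwallBound (hx : IsStateOf T x₀ q u x) (hu : IsAdmissibleControl T u)
    {L : NNReal} (hq : LipschitzWith L q) {t : ℝ} (ht : t ∈ Icc 0 T) :
    |x t - x₀| ≤ gronwallBound 0 L (|q x₀| + 1) T := by
  have hT : 0 ≤ T := ht.1.trans ht.2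
  have h0 : (0 : ℝ) ∈ Icc 0 T := ⟨le_rfl, hT⟩
  have hxc := hx.continuousOn hT
  -- Extending `x` continuously makes `h` continuous on the line, so its primitive is differentiable
  -- everywhere. Gronwall is applied to that primitive because `x` is differentiable only almost
  -- everywhere.
  set y : ℝ → ℝ := IccExtend hT ((Icc 0 T).domRestrict x) with hy
  have hyc : Continuous y := (continuousOn_iff_continuous_domRestrict.1 hxc).Icc_extend'
  have hyx : ∀ s ∈ Icc 0 T, y s = x s := fun s hs => by
    rw [hy, IccExtend_of_mem hT _ hs]; rfl
  set h : ℝ → ℝ := fun s => L * |y s - x₀| + (|q x₀| + 1) with hh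
  have hhc : Continuous h := by fun_prop
  have hpos : ∀ s, 0 ≤ h s := fun s => by positivity
  have key : ∀ s ∈ Icc 0 T, |x s - x₀| ≤ ∫ r in (0 : ℝ)..s, h r := by
    intro s hs
    rw [← hx.2.1, hx.sub_eq_integral h0 hs]
    refine intervalIntegral.norm_integral_le_of_norm_le (f := runningCost q u x) hs.1 ?_
      (hhc.intervalIntegrable _ _)
    filter_upwards [hu.ae_mem_uIoc h0 hs] with r hr hmem
    obtain ⟨h1, h2, -⟩ := hr (by rwa [uIoc_of_le hs.1])
    have h3 : |q (x r) - q x₀| ≤ L * |x r - x₀| := by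
      simpa [Real.dist_eq] using hq.dist_le_mul (x r) x₀
    have h4 : |q (x r)| ≤ L * |x r - x₀| + |q x₀| := by
      have := abs_sub_abs_le_abs_sub (q (x r)) (q x₀)
      linarith
    have h5 : |q (x r) * u r| ≤ |q (x r)| := by
      rw [abs_mul]; exact mul_le_of_le_one_right (abs_nonneg _) h1
    have h6 : |u r ^ 2| ≤ 1 := by
      rw [abs_of_nonneg (sq_nonneg _)]; exact (sq_le_one_iff_abs_le_one _).2 h1
    have h7 := abs_add_le (q (x r) * u r) (u r ^ 2)
    simp only [hh, hyx r h2, runningCost, Real.norm_eq_abs]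
    linarith
  have hderiv : ∀ s, HasDerivAt (fun s => ∫ r in (0 : ℝ)..s, h r) (h s) s := fun s =>
    (hhc.integral_hasStrictDerivAt 0 s).hasDerivAt
  have hG := norm_le_gronwallBound_of_norm_deriv_right_le (a := 0) (b := T) (δ := 0) (K := L)
    (ε := |q x₀| + 1) (f := fun s => ∫ r in (0 : ℝ)..s, h r) (f' := h)
    (fun s _ => (hderiv s).continuousAt.continuousWithinAt)
    (fun s _ => (hderiv s).hasDerivWithinAt) (by simp)
    (fun s hs => by
      have hs' : s ∈ Icc 0 T := Ico_subset_Icc_self hs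
      rw [Real.norm_of_nonneg (hpos s)]
      have h1 := key s hs'
      have h2 := le_abs_self (∫ r in (0 : ℝ)..s, h r)
      simp only [hh, hyx s hs']
      rw [Real.norm_eq_abs]
      have h3 := mul_le_mul_of_nonneg_left (h1.trans h2) L.2
      simp only [hh] at h3
      exact add_le_add_left h3 _) t ht
  refine ((key t ht).trans (le_abs_self _)).trans (hG.trans ?_)
  exact gronwallBound_mono le_rfl (by positivity) L.2 (by linarith [ht.2])

end IsStateOf

/-- States of admissible controls are equi-Lipschitz. -/
lemma exists_lipschitz_bound_state (T x₀ : ℝ) {q : ℝ → ℝ} {L : NNReal} (hq : LipschitzWith L q) :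
    ∃ K : ℝ, 0 ≤ K ∧ ∀ u x, IsAdmissibleControl T u → IsStateOf T x₀ q u x →
      ∀ s ∈ Icc 0 T, ∀ t ∈ Icc 0 T, |x s - x t| ≤ K * |s - t| := by
  set R := gronwallBound 0 L (|q x₀| + 1) T
  refine ⟨|L * R + |q x₀| + 1|, abs_nonneg _, fun u x hu hx s hs t ht => ?_⟩
  rw [hx.sub_eq_integral ht hs]
  refine (hu.abs_integral_runningCost_le (B := L * R + |q x₀|) (fun r hr => ?_) ht hs).trans ?_
  · have h3 : |q (x r) - q x₀| ≤ L * |x r - x₀| := by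
      simpa [Real.dist_eq] using hq.dist_le_mul (x r) x₀
    have h4 := abs_sub_abs_le_abs_sub (q (x r)) (q x₀)
    have h5 : L * |x r - x₀| ≤ L * R := by
      gcongr; exact hx.abs_sub_le_gronwallBound hu hq hr
    linarith
  · gcongr; exact le_abs_self _

/-- Pointwise compactness of equi-Lipschitz functions with a common value at `0`. -/
lemma exists_tendsto_of_equiLipschitz {T K a : ℝ} (F : Ultrafilter ℕ) (f : ℕ → ℝ → ℝ)
    (h0 : ∀ n, f n 0 = a)
    (hf : ∀ n, ∀ s ∈ Icc 0 T, ∀ t ∈ Icc 0 T, |f n s - f n t| ≤ K * |s - t|) :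
    ∃ g : ℝ → ℝ, (∀ t ∈ Icc 0 T, Tendsto (fun n => f n t) F (𝓝 (g t))) ∧
      ∀ s ∈ Icc 0 T, ∀ t ∈ Icc 0 T, |g s - g t| ≤ K * |s - t| := by
  have h : ∀ t ∈ Icc 0 T, ∃ y, Tendsto (fun n => f n t) F (𝓝 y) := by
    intro t ht
    have hmem : ∀ n, f n t ∈ Icc (a - K * |t|) (a + K * |t|) := fun n => by
      have := hf n t ht 0 ⟨le_rfl, ht.1.trans ht.2⟩
      rw [h0, sub_zero, abs_le] at this
      exact ⟨by linarith, by linarith⟩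
    obtain ⟨y, -, hy⟩ := isCompact_Icc.ultrafilter_le_nhds' (F.map fun n => f n t)
      (Ultrafilter.mem_map.2 (univ_mem' hmem))
    exact ⟨y, hy⟩
  choose! g hg using h
  refine ⟨g, hg, fun s hs t ht => ?_⟩
  exact le_of_tendsto ((hg s hs).sub (hg t ht)).abs (Eventually.of_forall fun n => hf n s hs t ht)

/-! ### From increment estimates to derivatives -/

lemma absolutelyContinuousOnInterval_of_abs_sub_le {T K : ℝ} (hT : 0 ≤ T) {g : ℝ → ℝ}
    (hg : ∀ s ∈ Icc 0 T, ∀ t ∈ Icc 0 T, |g s - g t| ≤ K * |s - t|) :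
    AbsolutelyContinuousOnInterval g 0 T := by
  refine LipschitzOnWith.absolutelyContinuousOnInterval (K := K.toNNReal) ?_
  rw [uIcc_of_le hT]
  exact LipschitzOnWith.of_dist_le' fun s hs t ht => hg s hs t ht

lemma HasDerivAt.nonneg_of_le_of_lt {g : ℝ → ℝ} {g' t T : ℝ} (ht : t ∈ Ico 0 T)
    (hg : HasDerivAt g g' t) (hle : ∀ s ∈ Icc 0 T, t < s → g t ≤ g s) : 0 ≤ g' := by
  refine ge_of_tendsto (hg.tendsto_slope.mono_left (nhdsGT_le_nhdsNE t)) ?_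
  filter_upwards [Ioc_mem_nhdsGT ht.2] with s hs
  rw [slope_def_field]
  exact div_nonneg (sub_nonneg.2 (hle s ⟨ht.1.trans hs.1.le, hs.2⟩ hs.1)) (sub_nonneg.2 hs.1.le)

lemma hasDerivAt_of_quadratic_error {X U M : ℝ → ℝ} {a u' m' t T K : ℝ} (ht : t ∈ Ioo 0 T)
    (hU : HasDerivAt U u' t) (hM : HasDerivAt M m' t)
    (h : ∀ s ∈ Icc 0 T, |X s - X t - a * (U s - U t) - (M s - M t)| ≤ K * |s - t| ^ 2) :
    HasDerivAt X (a * u' + m') t := by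
  have hR : HasDerivAt (fun s => X s - X t - a * (U s - U t) - (M s - M t)) 0 t := by
    rw [hasDerivAt_iff_isLittleO]
    have hO : (fun s => X s - X t - a * (U s - U t) - (M s - M t)) =O[𝓝 t]
        fun s => (s - t) ^ 2 := by
      refine Asymptotics.IsBigO.of_bound K ?_
      filter_upwards [Icc_mem_nhds ht.1 ht.2] with s hs
      simpa using h s hs
    have ho : (fun s => (s - t) ^ 2) =o[𝓝 t] fun s => s - t := by
      have h1 : Tendsto (fun s : ℝ => s - t) (𝓝 t) (𝓝 0) := by
        simpa using (continuous_id.sub continuous_const).tendsto (f := fun s : ℝ => s - t) t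
      simpa [Function.comp_def] using (Asymptotics.isLittleO_pow_id (𝕜 := ℝ) one_lt_two).comp_tendsto h1
    simpa using hO.trans_isLittleO ho
  have := ((hR.add ((hU.sub_const (U t)).const_mul a)).add (hM.sub_const (M t))).add_const (X t)
  refine (this.congr_deriv (by ring)).congr_of_eventuallyEq (Eventually.of_forall fun s => ?_)
  simp only [Pi.add_apply]
  ring

/-- Larger root of `w² + q w = q v + m`. -/
lemma larger_root_spec {q v m : ℝ} (hq : 0 < q) (hvm : v ^ 2 ≤ m) (hm : m ≤ 1) :
    let w := (-q + √(q ^ 2 + 4 * (q * v + m))) / 2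
    v ≤ w ∧ |w| ≤ 1 ∧ q * w + w ^ 2 = q * v + m := by
  intro w
  have hv : |v| ≤ 1 := (sq_le_one_iff_abs_le_one v).1 (hvm.trans hm)
  rw [abs_le] at hv
  -- The difference of the two sides is `4 (m - v²)`.
  have hD : (q + 2 * v) ^ 2 ≤ q ^ 2 + 4 * (q * v + m) := by nlinarith
  have h1 : q + 2 * v ≤ √(q ^ 2 + 4 * (q * v + m)) := Real.le_sqrt_of_sq_le hD
  have h2 : √(q ^ 2 + 4 * (q * v + m)) ≤ q + 2 := by
    rw [Real.sqrt_le_left (by linarith)]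
    nlinarith
  have h3 := Real.sq_sqrt ((sq_nonneg _).trans hD)
  have hw : v ≤ w := by simp only [w]; linarith
  refine ⟨hw, abs_le.2 ⟨by linarith, by simp only [w]; linarith⟩, ?_⟩
  simp only [w]
  linear_combination h3 / 4

lemma abs_comp_state_le {T x₀ K : ℝ} {f q u x : ℝ → ℝ} {L : NNReal} (hf : LipschitzWith L f)
    (hx : IsStateOf T x₀ q u x) (hK0 : 0 ≤ K)
    (hK : ∀ s ∈ Icc 0 T, ∀ t ∈ Icc 0 T, |x s - x t| ≤ K * |s - t|) {t : ℝ} (ht : t ∈ Icc 0 T) :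
    |f (x t)| ≤ |f x₀| + L * (K * T) := by
  have h3 : |f (x t) - f x₀| ≤ L * |x t - x₀| := by
    simpa [Real.dist_eq] using hf.dist_le_mul (x t) x₀
  have h4 := abs_sub_abs_le_abs_sub (f (x t)) (f x₀)
  have h5 := hK t ht 0 ⟨le_rfl, ht.1.trans ht.2⟩
  rw [hx.2.1, sub_zero, abs_of_nonneg ht.1] at h5
  have h6 : (L : ℝ) * |x t - x₀| ≤ L * (K * T) := by
    refine mul_le_mul_of_nonneg_left (h5.trans ?_) L.2
    exact mul_le_mul_of_nonneg_left ht.2 hK0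
  linarith

lemma exists_admissible_state {T x₀ : ℝ} (q : ℝ → ℝ) :
    ∃ u x, IsAdmissibleControl T u ∧ IsStateOf T x₀ q u x := by
  refine ⟨fun _ => 0, fun _ => x₀, ⟨aemeasurable_const, by simp⟩, ?_, rfl, ?_⟩
  · exact (LipschitzWith.const x₀).lipschitzOnWith.absolutelyContinuousOnInterval
  · exact Eventually.of_forall fun t => by simpa using hasDerivAt_const t x₀

/-- A relaxed minimizer: limits of the states, of the integrals of `u` and `u²`, and of the
accumulated costs along a minimizing sequence. -/
lemma exists_relaxed_minimizer {T x₀ : ℝ} (hT : 0 < T) {q c : ℝ → ℝ} {Lq Lc : NNReal}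
    (hq : LipschitzWith Lq q) (hc : LipschitzWith Lc c) :
    ∃ (X U M C : ℝ → ℝ), AbsolutelyContinuousOnInterval X 0 T ∧
      AbsolutelyContinuousOnInterval C 0 T ∧ X 0 = x₀ ∧ C 0 = 0 ∧
      (∀ᵐ t ∂(volume.restrict (Ioo 0 T)),
        HasDerivAt X (q (X t) * deriv U t + deriv M t) t ∧
        HasDerivAt C (c (X t) * deriv U t + deriv M t) t ∧
        deriv U t ^ 2 ≤ deriv M t ∧ deriv M t ≤ 1) ∧
      ∀ v y, IsAdmissibleControl T v → IsStateOf T x₀ q v y → C T ≤ totalCost T c v y := by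
  obtain ⟨K, hK0, hK⟩ := exists_lipschitz_bound_state T x₀ hq
  have h0 : (0 : ℝ) ∈ Icc 0 T := ⟨le_rfl, hT.le⟩
  have hTm : T ∈ Icc 0 T := ⟨hT.le, le_rfl⟩
  set B := |c x₀| + Lc * (K * T)
  have hB : ∀ u x, IsAdmissibleControl T u → IsStateOf T x₀ q u x →
      ∀ t ∈ Icc 0 T, |c (x t)| ≤ B := fun u x hu hx t ht =>
    abs_comp_state_le hc hx hK0 (hK u x hu hx) ht
  set S : Set ℝ := {r | ∃ u x, IsAdmissibleControl T u ∧ IsStateOf T x₀ q u x ∧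
    totalCost T c u x = r}
  have hSne : S.Nonempty := by
    obtain ⟨u, x, hu, hx⟩ := exists_admissible_state (T := T) (x₀ := x₀) q
    exact ⟨_, u, x, hu, hx, rfl⟩
  have hSb : BddBelow S := by
    refine ⟨-((B + 1) * |T - 0|), ?_⟩
    rintro _ ⟨u, x, hu, hx, rfl⟩
    exact (abs_le.1 (hu.abs_integral_runningCost_le (hB u x hu hx) h0 hTm)).1
  obtain ⟨r, -, hr, hrS⟩ := exists_seq_tendsto_sInf hSne hSb
  choose u x hu hx hux using hrS
  -- A nonprincipal ultrafilter gives all the pointwise limits at once, with no extraction of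
  -- subsequences.
  let F : Ultrafilter ℕ := hyperfilter ℕ
  have hF : (F : Filter ℕ) ≤ atTop := Nat.hyperfilter_le_atTop
  have hxc := fun n => (hx n).continuousOn hT.le
  have hKx := fun n => hK _ _ (hu n) (hx n)
  have hdiffU : ∀ n, ∀ s ∈ Icc 0 T, ∀ t ∈ Icc 0 T,
      (∫ τ in (0 : ℝ)..s, u n τ) - (∫ τ in (0 : ℝ)..t, u n τ) = ∫ τ in t..s, u n τ :=
    fun n s hs t ht => intervalIntegral.integral_interval_sub_left
      ((hu n).intervalIntegrable h0 hs) ((hu n).intervalIntegrable h0 ht)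
  have hdiffM : ∀ n, ∀ s ∈ Icc 0 T, ∀ t ∈ Icc 0 T,
      (∫ τ in (0 : ℝ)..s, u n τ ^ 2) - (∫ τ in (0 : ℝ)..t, u n τ ^ 2) = ∫ τ in t..s, u n τ ^ 2 :=
    fun n s hs t ht => intervalIntegral.integral_interval_sub_left
      ((hu n).intervalIntegrable_sq h0 hs) ((hu n).intervalIntegrable_sq h0 ht)
  have hdiffC : ∀ n, ∀ s ∈ Icc 0 T, ∀ t ∈ Icc 0 T,
      (∫ τ in (0 : ℝ)..s, runningCost c (u n) (x n) τ) -
        (∫ τ in (0 : ℝ)..t, runningCost c (u n) (x n) τ) =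
        ∫ τ in t..s, runningCost c (u n) (x n) τ :=
    fun n s hs t ht => intervalIntegral.integral_interval_sub_left
      ((hu n).intervalIntegrable_runningCost hc.continuous (hxc n) h0 hs)
      ((hu n).intervalIntegrable_runningCost hc.continuous (hxc n) h0 ht)
  obtain ⟨X, hX, hXK⟩ := exists_tendsto_of_equiLipschitz F x (fun n => (hx n).2.1) hKx
  obtain ⟨U, hU, hUK⟩ := exists_tendsto_of_equiLipschitz (T := T) (K := 1) F
    (fun n t => ∫ τ in (0 : ℝ)..t, u n τ) (fun n => intervalIntegral.integral_same)
    fun n s hs t ht => by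
      rw [hdiffU n s hs t ht]
      refine intervalIntegral.norm_integral_le_of_norm_le_const_ae (f := u n) ?_
      filter_upwards [(hu n).ae_mem_uIoc ht hs] with τ hτ hmem using (hτ hmem).1
  obtain ⟨M, hM, hMK⟩ := exists_tendsto_of_equiLipschitz (T := T) (K := 1) F
    (fun n t => ∫ τ in (0 : ℝ)..t, u n τ ^ 2) (fun n => intervalIntegral.integral_same)
    fun n s hs t ht => by
      rw [hdiffM n s hs t ht]
      refine intervalIntegral.norm_integral_le_of_norm_le_const_ae (f := fun τ => u n τ ^ 2) ?_
      filter_upwards [(hu n).ae_mem_uIoc ht hs] with τ hτ hmem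
      rw [Real.norm_of_nonneg (sq_nonneg _)]
      exact (sq_le_one_iff_abs_le_one _).2 (hτ hmem).1
  obtain ⟨C, hC, hCK⟩ := exists_tendsto_of_equiLipschitz (T := T) (K := B + 1) F
    (fun n t => ∫ τ in (0 : ℝ)..t, runningCost c (u n) (x n) τ)
    (fun n => intervalIntegral.integral_same)
    fun n s hs t ht => by
      rw [hdiffC n s hs t ht]
      exact (hu n).abs_integral_runningCost_le (hB _ _ (hu n) (hx n)) ht hs
  have hXerr : ∀ t ∈ Icc 0 T, ∀ s ∈ Icc 0 T,
      |X s - X t - q (X t) * (U s - U t) - (M s - M t)| ≤ Lq * K * |s - t| ^ 2 := by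
    intro t ht s hs
    refine le_of_tendsto ((((hX s hs).sub (hX t ht)).sub
      (((hq.continuous.tendsto _).comp (hX t ht)).mul ((hU s hs).sub (hU t ht)))).sub
      ((hM s hs).sub (hM t ht))).abs (Eventually.of_forall fun n => ?_)
    simp only [Function.comp_def]
    rw [(hx n).sub_eq_integral ht hs, hdiffU n s hs t ht, hdiffM n s hs t ht]
    exact (hu n).abs_integral_runningCost_sub_le hq (hxc n) (hKx n) hK0 ht hs
  have hCerr : ∀ t ∈ Icc 0 T, ∀ s ∈ Icc 0 T,
      |C s - C t - c (X t) * (U s - U t) - (M s - M t)| ≤ Lc * K * |s - t| ^ 2 := by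
    intro t ht s hs
    refine le_of_tendsto ((((hC s hs).sub (hC t ht)).sub
      (((hc.continuous.tendsto _).comp (hX t ht)).mul ((hU s hs).sub (hU t ht)))).sub
      ((hM s hs).sub (hM t ht))).abs (Eventually.of_forall fun n => ?_)
    simp only [Function.comp_def]
    rw [hdiffC n s hs t ht, hdiffU n s hs t ht, hdiffM n s hs t ht]
    exact (hu n).abs_integral_runningCost_sub_le hc (hxc n) (hKx n) hK0 ht hs
  have hMle : ∀ t ∈ Icc 0 T, ∀ s ∈ Icc 0 T, M s - M t ≤ |s - t| := by
    intro t ht s hs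
    simpa using (le_abs_self _).trans (hMK s hs t ht)
  -- The tangent-line bound `2 l u - l² ≤ u²` is linear in `u`, so it survives the limit.
  have hUM : ∀ l : ℝ, ∀ t ∈ Icc 0 T, ∀ s ∈ Icc 0 T, t < s →
      2 * l * (U s - U t) - l ^ 2 * (s - t) ≤ M s - M t := by
    intro l t ht s hs hts
    refine le_of_tendsto_of_tendsto ((((hU s hs).sub (hU t ht)).const_mul (2 * l)).sub_const _)
      ((hM s hs).sub (hM t ht)) (Eventually.of_forall fun n => ?_)
    simp only
    rw [hdiffU n s hs t ht, hdiffM n s hs t ht]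
    have h1 := (hu n).intervalIntegrable ht hs
    have h2 := (hu n).intervalIntegrable_sq ht hs
    have h3 : l ^ 2 * (s - t) = ∫ _ in t..s, l ^ 2 := by simp [mul_comm]
    rw [h3, ← intervalIntegral.integral_const_mul,
      ← intervalIntegral.integral_sub (h1.const_mul _) intervalIntegrable_const]
    refine intervalIntegral.integral_mono_on hts.le
      ((h1.const_mul _).sub intervalIntegrable_const) h2 fun τ _ => ?_
    nlinarith [sq_nonneg (u n τ - l)]
  have hUac := absolutelyContinuousOnInterval_of_abs_sub_le hT.le hUK
  have hMac := absolutelyContinuousOnInterval_of_abs_sub_le hT.le hMK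
  refine ⟨X, U, M, C, absolutelyContinuousOnInterval_of_abs_sub_le hT.le hXK,
    absolutelyContinuousOnInterval_of_abs_sub_le hT.le hCK, ?_, ?_, ?_, ?_⟩
  · exact tendsto_nhds_unique (hX 0 h0) (by simp [(hx _).2.1])
  · exact tendsto_nhds_unique (hC 0 h0) (by simp)
  · rw [ae_restrict_iff' measurableSet_Ioo]
    filter_upwards [hUac.ae_differentiableAt, hMac.ae_differentiableAt] with t hUt hMt ht
    have htI : t ∈ Icc 0 T := Ioo_subset_Icc_self ht
    rw [uIcc_of_le hT.le] at hUt hMt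
    have hU' := (hUt htI).hasDerivAt
    have hM' := (hMt htI).hasDerivAt
    refine ⟨hasDerivAt_of_quadratic_error ht hU' hM' (hXerr t htI),
      hasDerivAt_of_quadratic_error ht hU' hM' (hCerr t htI), ?_, ?_⟩
    · have hd := (hM'.sub (hU'.const_mul (2 * deriv U t))).add
        ((hasDerivAt_id t).const_mul (deriv U t ^ 2))
      have := hd.nonneg_of_le_of_lt ⟨htI.1, ht.2⟩ fun s hs hts => by
        have := hUM (deriv U t) t htI s hs hts
        simp only [Pi.add_apply, Pi.sub_apply, id]
        linarith
      linarith
    · have := ((hasDerivAt_id t).sub hM').nonneg_of_le_of_lt ⟨htI.1, ht.2⟩ fun s hs hts => by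
        have := hMle t htI s hs
        rw [abs_of_pos (sub_pos.2 hts)] at this
        simp only [Pi.sub_apply, id]
        linarith
      linarith
  · intro v y hv hy
    have h1 : Tendsto (fun n => totalCost T c (u n) (x n)) F (𝓝 (sInf S)) := by
      simp only [hux]; exact hr.mono_left hF
    rw [tendsto_nhds_unique (hC T hTm) h1]
    exact csInf_le hSb ⟨v, y, hv, hy, rfl⟩

/-! ### Recovering a genuine control from the relaxed minimizer -/

lemma exists_isOptimalControl_of_pos {T x₀ : ℝ} (hT : 0 < T) {q c : ℝ → ℝ} {Lq Lc : NNReal}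
    (hq : LipschitzWith Lq q) (hc : LipschitzWith Lc c) (hq0 : ∀ x, 0 < q x)
    (hqc : ∀ x, c x < q x) : ∃ u, IsOptimalControl T x₀ q c u := by
  obtain ⟨X, U, M, C, hXac, hCac, hX0, hC0, hae, hmin⟩ :=
    exists_relaxed_minimizer (x₀ := x₀) hT hq hc
  have h0 : (0 : ℝ) ∈ Icc 0 T := ⟨le_rfl, hT.le⟩
  have hTm : T ∈ Icc 0 T := ⟨hT.le, le_rfl⟩
  have hXc : ContinuousOn X (Icc 0 T) := by simpa [uIcc_of_le hT.le] using hXac.continuousOn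
  let w : ℝ → ℝ := fun t =>
    (-q (X t) + √(q (X t) ^ 2 + 4 * (q (X t) * deriv U t + deriv M t))) / 2
  have hw : ∀ᵐ t ∂(volume.restrict (Ioo 0 T)), deriv U t ≤ w t ∧ |w t| ≤ 1 ∧
      q (X t) * w t + w t ^ 2 = q (X t) * deriv U t + deriv M t := by
    filter_upwards [hae] with t ht using larger_root_spec (hq0 _) ht.2.2.1 ht.2.2.2
  have hwadm : IsAdmissibleControl T w := by
    refine ⟨?_, hw.mono fun t ht => ht.2.1⟩
    have hqX : AEMeasurable (fun t => q (X t)) (volume.restrict (Ioo 0 T)) :=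
      ((hq.continuous.comp_continuousOn hXc).mono Ioo_subset_Icc_self).aemeasurable
        measurableSet_Ioo
    have hU := (measurable_deriv U).aemeasurable (μ := volume.restrict (Ioo 0 T))
    have hM := (measurable_deriv M).aemeasurable (μ := volume.restrict (Ioo 0 T))
    exact (hqX.neg.add ((hqX.pow_const 2).add (((hqX.mul hU).add hM).const_mul 4)).sqrt).div_const 2
  have hstate : IsStateOf T x₀ q w X := by
    refine ⟨hXac, hX0, ?_⟩
    filter_upwards [hae, hw] with t ht hwt
    rw [hwt.2.2]
    exact ht.1
  refine ⟨w, hwadm, X, hstate, fun v y hv hy =>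
    ⟨hv.intervalIntegrable_runningCost hc.continuous (hy.continuousOn hT.le) h0 hTm, ?_⟩⟩
  refine le_trans ?_ (hmin v y hv hy)
  have hCT : C T = ∫ t in (0 : ℝ)..T, deriv C t := by
    rw [hCac.integral_deriv_eq_sub, hC0, sub_zero]
  rw [hCT]
  refine intervalIntegral.integral_mono_ae_restrict hT.le
    (hwadm.intervalIntegrable_runningCost hc.continuous hXc h0 hTm)
    hCac.intervalIntegrable_deriv ?_
  rw [← restrict_Ioo_eq_restrict_Icc]
  filter_upwards [hae, hw] with t ht hwt
  rw [ht.2.1.deriv, runningCost]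
  -- The gap `C' - (c w + w²)` equals `(q - c)(w - U')`, a product of nonnegative factors.
  nlinarith [hqc (X t), hwt.1, hwt.2.2]

lemma IsOptimalControl.neg {T x₀ : ℝ} {q c u : ℝ → ℝ}
    (h : IsOptimalControl T x₀ (fun z => -q z) (fun z => -c z) u) :
    IsOptimalControl T x₀ q c (fun t => -u t) := by
  have hcost : ∀ v y : ℝ → ℝ, runningCost (fun z => -c z) v y = runningCost c (fun t => -v t) y :=
    fun v y => by ext t; simp [runningCost]
  obtain ⟨hu, x, hx, hmin⟩ := h
  refine ⟨hu.neg, x, by simpa using hx.neg, fun v y hv hy => ?_⟩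
  have := hmin _ y hv.neg hy.neg
  simpa only [totalCost, hcost, neg_neg] using this

theorem mainTheorem10 (T x₀ : ℝ) (hT : 0 < T) (q c : ℝ → ℝ)
    (hq : ∃ L : NNReal, LipschitzWith L q) (hc : ∃ L : NNReal, LipschitzWith L c)
    (hqc : ∀ x : ℝ, 0 < q x * (q x - c x)) :
    ∃ u : ℝ → ℝ, IsOptimalControl T x₀ q c u := by
  obtain ⟨Lq, hq⟩ := hq
  obtain ⟨Lc, hc⟩ := hc
  have hne : ∀ x, q x ≠ 0 := fun x hx => by simpa [hx] using hqc x
  -- The hypothesis forbids zeros of `q`, so continuity fixes its sign.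
  have hsign : (∀ x, 0 < q x) ∨ ∀ x, q x < 0 := by
    by_contra! h
    obtain ⟨⟨a, ha⟩, b, hb⟩ := h
    obtain ⟨z, hz⟩ := mem_range_of_exists_le_of_exists_ge hq.continuous ⟨a, ha⟩ ⟨b, hb⟩
    exact hne z hz
  rcases hsign with hpos | hneg
  · exact exists_isOptimalControl_of_pos hT hq hc hpos fun x => by
      have := (mul_pos_iff_of_pos_left (hpos x)).1 (hqc x)
      linarith
  · obtain ⟨u, hu⟩ := exists_isOptimalControl_of_pos (x₀ := x₀) hT hq.neg hc.neg
      (fun x => by simpa using hneg x) fun x => by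
        have h2 := (neg_iff_neg_of_mul_pos (hqc x)).1 (hneg x)
        simp only [Pi.neg_apply]
        linarith
    exact ⟨_, IsOptimalControl.neg hu⟩
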